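/- Let $k$ be a field and let $H=(V,E)$ be a finite $d$-uniform hypergraph without repeated edges, $d\ge 1$: $V$ is a finite set and $E$ is a set of $d$-element subsets of $V$. For $e\in E$ put $x^e=\prod_{v\in e}x_v\in k[x_v: v\in V]$, let $k[H]=k[x^e:e\in E]$ be the edge subring of $H$, and let $I_H$, the toric ideal of $k[H]$, be the kernel of the $k$-algebra homomorphism $\varphi_H:k[t_e:e\in E]\to k[H]$, $t_e\mapsto x^e$. A bicolored multihypergraph over $H$ is a pair $\mathcal W=(B,R)$ of finite multisets of edges of $H$ (the blue and the red edges); its binomial is $f_{\mathcal W}=\prod_{e\in B}t_e-\prod_{e\in R}t_e$. It is balanced if $|B|+|R|$ is even and every vertex covered by $\mathcal W$ lies in as many blue as red edges, counted with multiplicity. A monomial walk on $H$ is a sequence $e_1,\dots,e_{2n}$ of edges of $H$ (repetitions allowed), $n\ge 1$, such that each $e_i$ with $i\ge 2$ meets some $e_j$ with $j<i$, and each covered vertex lies in as many odd-numbered as even-numbered edges of the sequence. Coloring odd-numbered edges blue and even-numbered edges red turns it into a bicolored multihypergraph. A monomial walk is primitive if there is no other monomial walk whose blue and red multisets are contained in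 its blue and red multisets, respectively, with at least one of these two containments proper. A bicolored primitive monomial hypergraph over $H$ is a balanced bicolored multihypergraph over $H$ that is the bicolored multihypergraph of some primitive monomial walk on $H$. Then the set of binomials $$\{\,f_{\mathcal W} : \mathcal W\text{ is a bicolored primitive monomial hypergraph over }H\,\}$$ is a universal Gröbner basis of $I_H$; that is, it is a finite subset of $I_H$ and, for every monomial order on $k[t_e:e\in E]$, the leading terms of its elements generate the ideal generated by the leading terms of all elements of $I_H$. (The set may contain $0$, which arises from the walks $e,e$; the leading term of $0$ is $0$.) -/

import Mathlib

universe u v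

namespace Hypergraph

/-- A hypergraph is `d`-uniform if every edge contains exactly `d` vertices. -/
def IsUniform {α : Type u} (H : Hypergraph α) (d : ℕ) : Prop :=
  ∀ e ∈ H.edgeSet, e.encard = d

section ToricIdeal

variable {α : Type u} (H : Hypergraph α) (k : Type v) [Field k]

/-- The squarefree monomial `x^e = ∏_{v ∈ e} x_v` of an edge `e`, in the polynomial ring
`k[x_v : v ∈ V(H)]`. (The product is the intended one because it is only used when the vertex set
is finite.) -/
noncomputable def edgeMonomial (e : H.edgeSet) : MvPolynomial H.vertexSet k :=
  ∏ᶠ (v : H.vertexSet) (_ : (v : α) ∈ (e : Set α)), MvPolynomial.X v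

/-- The edge subring `k[H] = k[x^e : e ∈ E(H)]` of `k[x_v : v ∈ V(H)]`. -/
noncomputable def edgeSubring : Subalgebra k (MvPolynomial H.vertexSet k) :=
  Algebra.adjoin k (Set.range (H.edgeMonomial k))

/-- The homomorphism `φ_H : k[t_e : e ∈ E(H)] → k[H]`, `t_e ↦ x^e`. -/
noncomputable def toricMap : MvPolynomial H.edgeSet k →ₐ[k] H.edgeSubring k :=
  MvPolynomial.aeval fun e =>
    (⟨H.edgeMonomial k e, Algebra.subset_adjoin (Set.mem_range_self e)⟩ : H.edgeSubring k)

/-- The toric ideal `I_H = ker φ_H` of the edge subring. -/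
noncomputable def toricIdeal : Ideal (MvPolynomial H.edgeSet k) :=
  RingHom.ker (H.toricMap k)

end ToricIdeal

/-- A bicolored multihypergraph over `H`: a finite multiset of edges of `H` in which every copy of
an edge is colored blue or red, given by the multiset of its blue and the multiset of its red
edges. -/
@[ext]
structure BicoloredMultihypergraph {α : Type u} (H : Hypergraph α) where
  blue : Multiset H.edgeSet
  red : Multiset H.edgeSet

namespace BicoloredMultihypergraph

variable {α : Type u} {H : Hypergraph α}

open Classical in
/-- The number of edges of a multiset, counted with multiplicity, that contain the vertex `v`. -/
noncomputable def degree (M : Multiset H.edgeSet) (v : α) : ℕ :=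
  M.countP fun e : H.edgeSet => v ∈ (e : Set α)

/-- A bicolored collection of an even number of edges is balanced if every vertex that it covers
has blue degree equal to red degree. -/
def IsBalanced (C : BicoloredMultihypergraph H) : Prop :=
  Even (Multiset.card (C.blue + C.red)) ∧
    ∀ v : α, (∃ e ∈ C.blue + C.red, v ∈ (e : Set α)) → degree C.blue v = degree C.red v

/-- The binomial `∏_{e blue} t_e - ∏_{e red} t_e`, with multiplicities. -/
noncomputable def binomial (k : Type v) [Field k] (C : BicoloredMultihypergraph H) :
    MvPolynomial H.edgeSet k :=
  (C.blue.map MvPolynomial.X).prod - (C.red.map MvPolynomial.X).prod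

/-- `C'` is properly contained in `C`, as bicolored multisets of edges. -/
def IsProperSub (C' C : BicoloredMultihypergraph H) : Prop :=
  C'.blue ≤ C.blue ∧ C'.red ≤ C.red ∧ C' ≠ C

end BicoloredMultihypergraph

/-- A monomial walk on `H`: a nonempty even sequence of edges `e_1, …, e_{2n}`, in which each edge
after the first one meets an earlier edge, and such that every covered vertex lies in as many
odd-numbered as even-numbered edges. The edge `e_j` is `edge i` with `i + 1 = j`. -/
structure MonomialWalk {α : Type u} (H : Hypergraph α) where
  n : ℕ
  n_pos : 0 < n
  edge : Fin (2 * n) → H.edgeSet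
  meets : ∀ i : Fin (2 * n), 0 < i.val →
    ∃ j : Fin (2 * n), j < i ∧ ((edge i : Set α) ∩ (edge j : Set α)).Nonempty
  balanced : ∀ v : α, (∃ i, v ∈ (edge i : Set α)) →
    {i : Fin (2 * n) | v ∈ (edge i : Set α) ∧ Odd (i.val + 1)}.ncard =
      {i : Fin (2 * n) | v ∈ (edge i : Set α) ∧ Even (i.val + 1)}.ncard

namespace MonomialWalk

variable {α : Type u} {H : Hypergraph α}

/-- The bicolored multihypergraph of a walk: odd-numbered edges are blue, even-numbered edges are
red. Its binomial is `f_W = ∏ t_{e_{2i-1}} - ∏ t_{e_{2i}}`. -/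
def bicoloring (W : MonomialWalk H) : BicoloredMultihypergraph H where
  blue := (Finset.univ.filter fun i : Fin (2 * W.n) => Odd (i.val + 1)).val.map W.edge
  red := (Finset.univ.filter fun i : Fin (2 * W.n) => Even (i.val + 1)).val.map W.edge

/-- A monomial walk is primitive if no proper subcollection of its odd- and even-numbered edges
is again a (nonempty) monomial walk. -/
def IsPrimitive (W : MonomialWalk H) : Prop :=
  ¬ ∃ W' : MonomialWalk H, W'.bicoloring.IsProperSub W.bicoloring

end MonomialWalk

/-- A bicolored primitive monomial hypergraph over `H`: a multihypergraph with edges in `H`,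
together with a balanced bicoloring that makes the corresponding monomial walk primitive. -/
def BicoloredMultihypergraph.IsPrimitiveMonomial {α : Type u} {H : Hypergraph α}
    (C : BicoloredMultihypergraph H) : Prop :=
  C.IsBalanced ∧ ∃ W : MonomialWalk H, W.bicoloring = C ∧ W.IsPrimitive

end Hypergraph

/-- `G` is a Gröbner basis of the ideal `I` with respect to the monomial order `m`: a finite subset
of `I` whose leading terms generate the ideal of leading terms of the elements of `I`. The zero
polynomial, whose leading term is `0`, is allowed in `G`. -/
def IsGroebnerBasis {σ : Type u} {k : Type v} [Field k] (m : MonomialOrder.{u, u} σ)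
    (G : Set (MvPolynomial σ k)) (I : Ideal (MvPolynomial σ k)) : Prop :=
  G.Finite ∧ G ⊆ I ∧
    Ideal.span (m.leadingTerm '' G) = Ideal.span (m.leadingTerm '' (I : Set (MvPolynomial σ k)))

/-- `G` is a universal Gröbner basis of `I`: a Gröbner basis with respect to every monomial order.
(The order lives on a copy of `σ →₀ ℕ`, so the universe of `σ` accommodates all of them.) -/
def IsUniversalGroebnerBasis {σ : Type u} {k : Type v} [Field k]
    (G : Set (MvPolynomial σ k)) (I : Ideal (MvPolynomial σ k)) : Prop :=
  ∀ m : MonomialOrder.{u, u} σ, IsGroebnerBasis m G I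

/-! Call a pair of edge multisets balanced if all blue and red degrees agree. Since the degrees of a
multiset form the exponent of the image of its monomial, balanced pairs are exactly the pairs of
monomials with equal image under `toricMap`. The minimal nonzero balanced pairs play the role of a
Graver basis.

For nonzero `f` in the ideal, the leading monomial shares its fiber with another, smaller monomial
of `f`, since otherwise its image could not cancel. This balanced pair contains a minimal pair
ordered in the same direction (`exists_isMinimalPair_lt`), whose binomial has a leading term
dividing that of `f`.

It remains to see that a minimal pair is the bicoloring of a primitive walk. Its edges are listed
greedily, alternating blue and red: if no unused edge of the required color met the edges listed so
far, double counting with uniformity would contradict minimality (`exists_blue_meeting`) or the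
color counts (`exists_red_meeting`). Primitivity follows because every walk gives a nonzero balanced
pair. Finiteness is Dickson's lemma. -/

namespace Hypergraph

namespace BicoloredMultihypergraph

variable {α : Type u} {H : Hypergraph α}

/-! ### Vertex degrees and double counting -/

section Degree

variable (M N : Multiset H.edgeSet) (v : α)

@[simp]
lemma degree_zero : degree (0 : Multiset H.edgeSet) v = 0 := by
  simp [degree]

@[simp]
lemma degree_add : degree (M + N) v = degree M v + degree N v := by
  classical
  exact Multiset.countP_add _ _ _

open Classical in
lemma degree_cons (e : H.edgeSet) :
    degree (e ::ₘ M) v = degree M v + if v ∈ (e : Set α) then 1 else 0 := by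
  simp [degree, Multiset.countP_cons]

variable {M N}

lemma degree_mono (h : M ≤ N) : degree M v ≤ degree N v := by
  classical
  exact Multiset.countP_le_of_le _ h

variable {v}

lemma degree_pos_iff : 0 < degree M v ↔ ∃ e ∈ M, v ∈ (e : Set α) := by
  classical
  simp only [degree, Multiset.countP_pos]

lemma degree_eq_zero_iff : degree M v = 0 ↔ ∀ e ∈ M, v ∉ (e : Set α) := by
  rw [← not_iff_not, ← ne_eq, ← Nat.pos_iff_ne_zero, degree_pos_iff]
  simp

/-- Double counting of the incidences between the edges of `M` and a set of vertices that contains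
all of them. -/
lemma sum_degree {d : ℕ} (hH : H.IsUniform d) {T : Finset α}
    (hT : ∀ e ∈ M, (e : Set α) ⊆ T) : ∑ v ∈ T, degree M v = d * Multiset.card M := by
  classical
  induction M using Multiset.induction_on with
  | empty => simp
  | cons e M ih =>
    have hcard : (T.filter fun v => v ∈ (e : Set α)).card = d := by
      have h := hH e e.2
      have he : ((T.filter fun v => v ∈ (e : Set α) : Finset α) : Set α) = e := by
        ext v
        simpa using fun hv => hT e (Multiset.mem_cons_self e M) hv
      rw [← he, Set.encard_coe_eq_coe_finsetCard] at h
      exact_mod_cast h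
    simp only [degree_cons, Finset.sum_add_distrib, Finset.sum_boole, hcard, Multiset.card_cons,
      ih fun e' he' => hT e' (Multiset.mem_cons_of_mem he')]
    simp [mul_add]

lemma degree_filter_map {N : ℕ} (f : Fin N → H.edgeSet) (q : Fin N → Prop) [DecidablePred q]
    (v : α) :
    degree ((Finset.univ.filter q).val.map f) v = {i | v ∈ (f i : Set α) ∧ q i}.ncard := by
  classical
  have h : {i | v ∈ (f i : Set α) ∧ q i} =
      (((Finset.univ.filter q).filter fun i => v ∈ (f i : Set α) : Finset (Fin N)) : Set (Fin N)) := by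
    ext i
    simp [and_comm]
  rw [h, Set.ncard_coe_finset, degree, Multiset.countP_map, ← Finset.filter_val]
  rfl

end Degree

/-! ### Balanced pairs -/

/-- Every vertex lies in as many blue as red edges. -/
def DegreesAgree (p : Multiset H.edgeSet × Multiset H.edgeSet) : Prop :=
  ∀ v, degree p.1 v = degree p.2 v

/-- A pair of multisets of edges that is minimal among the nonzero pairs with equal degrees. -/
abbrev IsMinimalPair (p : Multiset H.edgeSet × Multiset H.edgeSet) : Prop :=
  Minimal (fun q => q ≠ 0 ∧ DegreesAgree q) p

lemma DegreesAgree.tsub {p q : Multiset H.edgeSet × Multiset H.edgeSet} (hp : DegreesAgree p)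
    (hq : DegreesAgree q) (h : q ≤ p) : DegreesAgree (p - q) := by
  intro v
  have h1 := degree_add (p.1 - q.1) q.1 v
  have h2 := degree_add (p.2 - q.2) q.2 v
  rw [tsub_add_cancel_of_le h.1] at h1
  rw [tsub_add_cancel_of_le h.2] at h2
  have := hp v
  have := hq v
  simp only [Prod.fst_sub, Prod.snd_sub]
  omega

lemma DegreesAgree.card_eq {d : ℕ} (hV : H.vertexSet.Finite) (hd : 1 ≤ d) (hH : H.IsUniform d)
    {p : Multiset H.edgeSet × Multiset H.edgeSet} (hp : DegreesAgree p) :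
    Multiset.card p.1 = Multiset.card p.2 := by
  have hT : ∀ e : H.edgeSet, (e : Set α) ⊆ hV.toFinset := fun e => by
    simp [H.subset_vertexSet_of_mem_edgeSet' e.2]
  have h : d * Multiset.card p.1 = d * Multiset.card p.2 := by
    rw [← sum_degree hH fun e _ => hT e, ← sum_degree hH fun e _ => hT e]
    exact Finset.sum_congr rfl fun v _ => hp v
  exact Nat.eq_of_mul_eq_mul_left hd h

/-! ### Extending a partial listing of a minimal pair -/

section Extension

variable {p q : Multiset H.edgeSet × Multiset H.edgeSet}

/-- The finite set of the vertices covered by a pair of multisets of edges. -/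
lemma exists_finset_covered (hV : H.vertexSet.Finite)
    (q : Multiset H.edgeSet × Multiset H.edgeSet) :
    ∃ T : Finset α, ∀ v, v ∈ T ↔ ∃ e ∈ q.1 + q.2, v ∈ (e : Set α) := by
  have hfin : {v | ∃ e ∈ q.1 + q.2, v ∈ (e : Set α)}.Finite :=
    hV.subset fun v ⟨e, _, hv⟩ => H.subset_vertexSet_of_mem_edgeSet' e.2 hv
  exact ⟨hfin.toFinset, fun v => by simp⟩

lemma degree_eq_of_forall_disjoint {A U : Multiset H.edgeSet} (h : U ≤ A) {v : α}
    (hA : ∀ e ∈ A - U, v ∉ (e : Set α)) : degree A v = degree U v := by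
  conv_lhs => rw [← tsub_add_cancel_of_le h]
  rw [degree_add, degree_eq_zero_iff.2 hA, zero_add]

/-- Otherwise `q` already has all blue edges of `p` at the vertices `T` it covers. There its red
degrees are at most those of `p`, hence at most its blue degrees. Both colors have the same degree
sum over `T`, so `q` is balanced, against minimality of `p`. -/
lemma exists_blue_meeting {d : ℕ} (hV : H.vertexSet.Finite) (hH : H.IsUniform d)
    (hp : IsMinimalPair p) (hqp : q < p) (hq : q ≠ 0)
    (hcard : Multiset.card q.1 = Multiset.card q.2) :
    ∃ e ∈ p.1 - q.1, ∃ e' ∈ q.1 + q.2, ((e : Set α) ∩ (e' : Set α)).Nonempty := by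
  by_contra! hdis
  obtain ⟨T, hT⟩ := exists_finset_covered hV q
  have hblue : ∀ v ∈ T, degree p.1 v = degree q.1 v := fun v hv => by
    refine degree_eq_of_forall_disjoint hqp.le.1 fun e he hve => ?_
    obtain ⟨e', he', hve'⟩ := (hT v).1 hv
    exact (hdis e he e' he').subset ⟨hve, hve'⟩
  have hsum1 := sum_degree (M := q.1) hH (T := T) fun e he v hv =>
    (hT v).2 ⟨e, Multiset.mem_add.2 (.inl he), hv⟩
  have hsum2 := sum_degree (M := q.2) hH (T := T) fun e he v hv =>
    (hT v).2 ⟨e, Multiset.mem_add.2 (.inr he), hv⟩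
  have hle : ∀ v ∈ T, degree q.2 v ≤ degree q.1 v := fun v hv => by
    rw [← hblue v hv, hp.prop.2 v]
    exact degree_mono v hqp.le.2
  have heq := (Finset.sum_eq_sum_iff_of_le hle).1 (by rw [hsum1, hsum2, hcard])
  have hagree : DegreesAgree q := fun v => by
    by_cases hv : v ∈ T
    · exact (heq v hv).symm
    · have hv' := fun e he hve => hv ((hT v).2 ⟨e, he, hve⟩)
      rw [degree_eq_zero_iff.2 fun e he => hv' e (Multiset.mem_add.2 (.inl he)),
        degree_eq_zero_iff.2 fun e he => hv' e (Multiset.mem_add.2 (.inr he))]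
  exact hp.not_prop_of_lt hqp ⟨hq, hagree⟩

/-- Otherwise `q` has all red edges of `p` on its covered vertices, so its red degrees dominate its
blue ones; summing gives at least as many red as blue edges. Balance of `p` suffices here, without
minimality. -/
lemma exists_red_meeting {d : ℕ} (hV : H.vertexSet.Finite) (hd : 1 ≤ d) (hH : H.IsUniform d)
    (hp : DegreesAgree p) (hqp : q ≤ p) (hcard : Multiset.card q.2 < Multiset.card q.1) :
    ∃ e ∈ p.2 - q.2, ∃ e' ∈ q.1 + q.2, ((e : Set α) ∩ (e' : Set α)).Nonempty := by
  by_contra! hdis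
  obtain ⟨T, hT⟩ := exists_finset_covered hV q
  have hred : ∀ v ∈ T, degree p.2 v = degree q.2 v := fun v hv => by
    refine degree_eq_of_forall_disjoint hqp.2 fun e he hve => ?_
    obtain ⟨e', he', hve'⟩ := (hT v).1 hv
    exact (hdis e he e' he').subset ⟨hve, hve'⟩
  have hsum1 := sum_degree (M := q.1) hH (T := T) fun e he v hv =>
    (hT v).2 ⟨e, Multiset.mem_add.2 (.inl he), hv⟩
  have hsum2 := sum_degree (M := q.2) hH (T := T) fun e he v hv =>
    (hT v).2 ⟨e, Multiset.mem_add.2 (.inr he), hv⟩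
  have hle : ∑ v ∈ T, degree q.1 v ≤ ∑ v ∈ T, degree q.2 v :=
    Finset.sum_le_sum fun v hv => by
      rw [← hred v hv, ← hp v]
      exact degree_mono v hqp.1
  rw [hsum1, hsum2] at hle
  exact absurd (Nat.le_of_mul_le_mul_left hle hd) (not_le.2 hcard)

end Extension

/-! ### Alternating sequences -/

/-- The blue and the red part of the first `n` pairs of edges of a sequence. -/
def alternatingParts (f : ℕ → H.edgeSet) (n : ℕ) : Multiset H.edgeSet × Multiset H.edgeSet :=
  ((Multiset.range n).map fun i => f (2 * i), (Multiset.range n).map fun i => f (2 * i + 1))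

lemma alternatingParts_succ (f : ℕ → H.edgeSet) (n : ℕ) :
    alternatingParts f (n + 1) =
      (f (2 * n) ::ₘ (alternatingParts f n).1, f (2 * n + 1) ::ₘ (alternatingParts f n).2) := by
  simp [alternatingParts, Multiset.range_succ]

lemma alternatingParts_congr {f g : ℕ → H.edgeSet} {n : ℕ} (h : ∀ i < 2 * n, f i = g i) :
    alternatingParts f n = alternatingParts g n := by
  rw [alternatingParts, alternatingParts]
  congr 1 <;>
  · refine Multiset.map_congr rfl fun i hi => h _ ?_
    have := Multiset.mem_range.1 hi
    omega

lemma exists_index_of_mem_alternatingParts {f : ℕ → H.edgeSet} {n : ℕ} {e : H.edgeSet}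
    (he : e ∈ (alternatingParts f n).1 + (alternatingParts f n).2) : ∃ j < 2 * n, f j = e := by
  simp only [alternatingParts] at he
  rcases Multiset.mem_add.1 he with h | h <;>
  · obtain ⟨i, hi, rfl⟩ := Multiset.mem_map.1 h
    exact ⟨_, by have := Multiset.mem_range.1 hi; omega, rfl⟩

lemma exists_alternating_sequence {d : ℕ} (hV : H.vertexSet.Finite) (hd : 1 ≤ d)
    (hH : H.IsUniform d) {p : Multiset H.edgeSet × Multiset H.edgeSet} (hp : IsMinimalPair p)
    (n : ℕ) (hn : n ≤ Multiset.card p.1) :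
    ∃ f : ℕ → H.edgeSet, alternatingParts f n ≤ p ∧
      ∀ i < 2 * n, 0 < i → ∃ j < i, ((f i : Set α) ∩ (f j : Set α)).Nonempty := by
  induction n with
  | zero =>
    -- Sequences are total functions on `ℕ`, so even the empty stage needs an edge as a junk value.
    obtain ⟨e, -⟩ : ∃ e, e ∈ p.1 := by
      rw [← Multiset.card_pos_iff_exists_mem]
      by_contra h
      have h1 : Multiset.card p.1 = 0 := by omega
      have h2 := hp.prop.2.card_eq hV hd hH
      exact hp.prop.1 (Prod.ext (Multiset.card_eq_zero.1 h1)
        (Multiset.card_eq_zero.1 (h2.symm.trans h1)))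
    exact ⟨fun _ => e, by simp [alternatingParts, Prod.le_def], by simp⟩
  | succ n ih =>
    obtain ⟨f, hf, hmeet⟩ := ih (by omega)
    set q := alternatingParts f n with hqdef
    have hq1 : Multiset.card q.1 = n := by simp [hqdef, alternatingParts]
    have hq2 : Multiset.card q.2 = n := by simp [hqdef, alternatingParts]
    obtain ⟨b, hb, hbmeet⟩ : ∃ b ∈ p.1 - q.1,
        0 < n → ∃ e' ∈ q.1 + q.2, ((b : Set α) ∩ (e' : Set α)).Nonempty := by
      -- The first edge of the walk is an arbitrary blue one; only later blue edges have to meet an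
      -- earlier edge.
      rcases Nat.eq_zero_or_pos n with rfl | hpos
      · obtain ⟨b, hb⟩ := Multiset.card_pos_iff_exists_mem.1 (show 0 < Multiset.card p.1 by omega)
        exact ⟨b, by rwa [Multiset.card_eq_zero.1 hq1, tsub_zero], fun h => absurd h (by simp)⟩
      · have hlt : q < p := hf.lt_of_ne fun h => by rw [← h] at hn; omega
        have hne : q ≠ 0 := fun h => by simp [h] at hq1; omega
        obtain ⟨b, hb, h⟩ := exists_blue_meeting hV hH hp hlt hne (hq1.trans hq2.symm)
        exact ⟨b, hb, fun _ => h⟩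
    have hcons {A U : Multiset H.edgeSet} {e : H.edgeSet} (h : U ≤ A) (he : e ∈ A - U) :
        e ::ₘ U ≤ A := by
      have := add_le_add_left (Multiset.singleton_le.2 he) U
      rwa [tsub_add_cancel_of_le h, Multiset.singleton_add] at this
    obtain ⟨r, hr, e', he', hrmeet⟩ := exists_red_meeting (q := (b ::ₘ q.1, q.2)) hV hd hH
      hp.prop.2 ⟨hcons hf.1 hb, hf.2⟩ (by simp [hq1, hq2])
    let g : ℕ → H.edgeSet := fun i => if i < 2 * n then f i else if i = 2 * n then b else r
    have hg : ∀ i < 2 * n, g i = f i := fun i hi => if_pos hi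
    have hgb : g (2 * n) = b := by simp [g]
    have hgr : g (2 * n + 1) = r := by simp [g]
    refine ⟨g, ?_, fun i hi hpos => ?_⟩
    · rw [alternatingParts_succ, alternatingParts_congr hg, hgb, hgr]
      exact ⟨hcons hf.1 hb, hcons hf.2 hr⟩
    · obtain h | rfl | rfl : i < 2 * n ∨ i = 2 * n ∨ i = 2 * n + 1 := by omega
      · obtain ⟨j, hj, hne⟩ := hmeet i h hpos
        exact ⟨j, hj, by rwa [hg i h, hg j (hj.trans h)]⟩
      · obtain ⟨e', he', hne⟩ := hbmeet (by omega)
        obtain ⟨j, hj, rfl⟩ := exists_index_of_mem_alternatingParts he'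
        exact ⟨j, hj, by rwa [hgb, hg j hj]⟩
      · rw [hgr]
        simp only [Multiset.cons_add, Multiset.mem_cons] at he'
        rcases he' with rfl | he'
        · exact ⟨2 * n, by omega, by rwa [hgb]⟩
        · obtain ⟨j, hj, rfl⟩ := exists_index_of_mem_alternatingParts he'
          exact ⟨j, by omega, by rwa [hg j hj]⟩

/-- Bridges the parity filters on `Fin (2 * n)` in `MonomialWalk.bicoloring` and the ranges in
`alternatingParts`. As numbering starts at 1, blue edges sit at the even indices. -/
lemma filter_map_eq_range_map {β : Type*} (f : ℕ → β) {N n : ℕ} (q : ℕ → Prop) [DecidablePred q]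
    (g : ℕ → ℕ) (hg : Function.Injective g) (h : ∀ i, (i < N ∧ q i) ↔ ∃ j < n, g j = i) :
    ((Finset.univ.filter fun i : Fin N => q i.val).val.map fun i => f i.val) =
      (Multiset.range n).map fun i => f (g i) := by
  have hfin : (Finset.univ.filter fun i : Fin N => q i.val).map Fin.valEmbedding =
      (Finset.range n).map ⟨g, hg⟩ := by
    ext i
    refine Iff.trans ?_ ((h i).trans (by simp))
    simp only [Finset.mem_map, Finset.mem_filter, Finset.mem_univ, true_and]
    exact ⟨fun ⟨j, hj, hji⟩ => hji ▸ ⟨j.isLt, hj⟩, fun ⟨hi, hq⟩ => ⟨⟨i, hi⟩, hq, rfl⟩⟩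
  have hval := congrArg (fun s : Finset ℕ => s.val.map f) hfin
  simp only [Finset.map_val, Multiset.map_map] at hval
  exact hval

lemma filter_odd_succ_map (f : ℕ → H.edgeSet) (n : ℕ) :
    ((Finset.univ.filter fun i : Fin (2 * n) => Odd (i.val + 1)).val.map fun i => f i.val) =
      (alternatingParts f n).1 :=
  filter_map_eq_range_map f (fun i => Odd (i + 1)) (fun i => 2 * i)
    (fun i j hij => by simpa using hij)
    fun i => ⟨fun ⟨hi, j, hj⟩ => ⟨j, by omega, by omega⟩,
      fun ⟨j, hj, hji⟩ => ⟨by omega, j, by omega⟩⟩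

lemma filter_even_succ_map (f : ℕ → H.edgeSet) (n : ℕ) :
    ((Finset.univ.filter fun i : Fin (2 * n) => Even (i.val + 1)).val.map fun i => f i.val) =
      (alternatingParts f n).2 :=
  filter_map_eq_range_map f (fun i => Even (i + 1)) (fun i => 2 * i + 1)
    (fun i j hij => by simpa using hij)
    fun i => ⟨fun ⟨hi, j, hj⟩ => ⟨j - 1, by omega, by omega⟩,
      fun ⟨j, hj, hji⟩ => ⟨by omega, j + 1, by omega⟩⟩

end BicoloredMultihypergraph

/-! ### Walks and minimal pairs -/

open BicoloredMultihypergraph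

variable {α : Type u} {H : Hypergraph α}

lemma MonomialWalk.degreesAgree (W : MonomialWalk H) :
    DegreesAgree (W.bicoloring.blue, W.bicoloring.red) := by
  intro v
  by_cases hv : ∃ i, v ∈ (W.edge i : Set α)
  · simpa only [bicoloring, degree_filter_map] using W.balanced v hv
  · push Not at hv
    simp only [bicoloring, degree_filter_map, hv, false_and]

lemma MonomialWalk.bicoloring_ne_zero (W : MonomialWalk H) :
    (W.bicoloring.blue, W.bicoloring.red) ≠ 0 := by
  intro h
  have hpos : 0 < 2 * W.n := Nat.mul_pos two_pos W.n_pos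
  have h0 : W.edge ⟨0, hpos⟩ ∈ W.bicoloring.blue := by
    simp only [bicoloring]
    exact Multiset.mem_map_of_mem _ (by simp)
  rw [show W.bicoloring.blue = 0 from (Prod.ext_iff.1 h).1] at h0
  exact Multiset.notMem_zero _ h0

namespace BicoloredMultihypergraph

lemma IsMinimalPair.exists_walk {d : ℕ} (hV : H.vertexSet.Finite) (hd : 1 ≤ d)
    (hH : H.IsUniform d) {p : Multiset H.edgeSet × Multiset H.edgeSet} (hp : IsMinimalPair p) :
    ∃ W : MonomialWalk H, W.bicoloring = ⟨p.1, p.2⟩ := by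
  have hcard := hp.prop.2.card_eq hV hd hH
  obtain ⟨f, hf, hmeet⟩ := exists_alternating_sequence hV hd hH hp _ le_rfl
  set n := Multiset.card p.1 with hn
  have h1 : (alternatingParts f n).1 = p.1 :=
    Multiset.eq_of_le_of_card_le hf.1 (by simp [alternatingParts, hn])
  have h2 : (alternatingParts f n).2 = p.2 :=
    Multiset.eq_of_le_of_card_le hf.2 (by simp [alternatingParts, hcard])
  refine ⟨{ n := n, n_pos := ?_, edge := fun i => f i.val, meets := fun i hi => ?_,
            balanced := fun v _ => ?_ }, ?_⟩
  · rw [Nat.pos_iff_ne_zero]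
    intro h
    exact hp.prop.1 (Prod.ext (Multiset.card_eq_zero.1 h)
      (Multiset.card_eq_zero.1 (hcard.symm.trans h)))
  · obtain ⟨j, hj, hne⟩ := hmeet i.val i.isLt hi
    exact ⟨⟨j, hj.trans i.isLt⟩, hj, hne⟩
  · rw [← degree_filter_map (fun i : Fin (2 * n) => f i.val), filter_odd_succ_map,
      ← degree_filter_map (fun i : Fin (2 * n) => f i.val), filter_even_succ_map, h1, h2]
    exact hp.prop.2 v
  · simp only [MonomialWalk.bicoloring, filter_odd_succ_map, filter_even_succ_map, h1, h2]

lemma IsMinimalPair.isPrimitiveMonomial {d : ℕ} (hV : H.vertexSet.Finite) (hd : 1 ≤ d)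
    (hH : H.IsUniform d) {p : Multiset H.edgeSet × Multiset H.edgeSet} (hp : IsMinimalPair p) :
    IsPrimitiveMonomial (H := H) ⟨p.1, p.2⟩ := by
  obtain ⟨W, hW⟩ := hp.exists_walk hV hd hH
  refine ⟨⟨?_, fun v _ => hp.prop.2 v⟩, W, hW, ?_⟩
  · rw [Multiset.card_add, hp.prop.2.card_eq hV hd hH]
    exact Even.add_self _
  · rintro ⟨W', hle1, hle2, hne⟩
    rw [hW] at hle1 hle2 hne
    have hle : (W'.bicoloring.blue, W'.bicoloring.red) ≤ p := ⟨hle1, hle2⟩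
    refine hp.not_prop_of_lt (hle.lt_of_ne fun h => hne ?_)
      ⟨W'.bicoloring_ne_zero, W'.degreesAgree⟩
    exact BicoloredMultihypergraph.ext (Prod.ext_iff.1 h).1 (Prod.ext_iff.1 h).2

lemma IsPrimitiveMonomial.degreesAgree {C : BicoloredMultihypergraph H}
    (hC : C.IsPrimitiveMonomial) : DegreesAgree (C.blue, C.red) := by
  obtain ⟨-, W, rfl, -⟩ := hC
  exact W.degreesAgree

lemma finite_edgeSet (hV : H.vertexSet.Finite) : Finite H.edgeSet :=
  (hV.finite_subsets.subset fun _ he => H.subset_vertexSet_of_mem_edgeSet' he).to_subtype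

/-- Primitivity makes these pairs pairwise incomparable, and antichains of exponent vectors over a
finite edge set are finite by Dickson's lemma. -/
lemma finite_isPrimitiveMonomial (hV : H.vertexSet.Finite) :
    {C : BicoloredMultihypergraph H | C.IsPrimitiveMonomial}.Finite := by
  classical
  have := finite_edgeSet hV
  let toPair : BicoloredMultihypergraph H → (H.edgeSet →₀ ℕ) × (H.edgeSet →₀ ℕ) := fun C =>
    (Multiset.toFinsupp C.blue, Multiset.toFinsupp C.red)
  have hle {A B : Multiset H.edgeSet} (h : Multiset.toFinsupp A ≤ Multiset.toFinsupp B) :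
      A ≤ B := Multiset.le_iff_count.2 fun e => h e
  have hinj : Function.Injective toPair := fun C C' h =>
    BicoloredMultihypergraph.ext (Multiset.toFinsupp.injective (Prod.ext_iff.1 h).1)
      (Multiset.toFinsupp.injective (Prod.ext_iff.1 h).2)
  refine Set.Finite.of_finite_image (f := toPair) ?_ hinj.injOn
  refine WellQuasiOrderedLE.finite_of_isAntichain ?_
  rintro _ ⟨C, hC, rfl⟩ _ ⟨C', hC', rfl⟩ hne h
  obtain ⟨-, W, rfl, -⟩ := hC
  obtain ⟨-, W', rfl, hW'⟩ := hC'
  exact hW' ⟨W, hle h.1, hle h.2, fun h' => hne (by rw [h'])⟩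

/-- If a pair with equal degrees is ordered strictly by an additive order, then it contains a
minimal pair that is ordered strictly in the same way. -/
lemma exists_isMinimalPair_lt {Γ : Type*} [AddCommMonoid Γ] [LinearOrder Γ]
    [IsOrderedCancelAddMonoid Γ] (w : Multiset H.edgeSet →+ Γ)
    (p : Multiset H.edgeSet × Multiset H.edgeSet) (hp : DegreesAgree p) (hw : w p.2 < w p.1) :
    ∃ q ≤ p, IsMinimalPair q ∧ w q.2 < w q.1 := by
  induction p using WellFoundedLT.induction with
  | ind p ih =>
  have hp0 : p ≠ 0 := by
    rintro rfl
    simp at hw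
  obtain ⟨q, hqp, hq⟩ := exists_minimal_le_of_wellFoundedLT
    (fun q => q ≠ 0 ∧ DegreesAgree q) p ⟨hp0, hp⟩
  rcases lt_or_ge (w q.2) (w q.1) with h | h
  · exact ⟨q, hqp, hq, h⟩
  -- A minimal pair ordered the wrong way or tied is removed: by additivity of `w` the balanced
  -- remainder still satisfies the strict inequality, and it is smaller than `p`.
  · have h1 : w (p.1 - q.1) + w q.1 = w p.1 := by rw [← map_add, tsub_add_cancel_of_le hqp.1]
    have h2 : w (p.2 - q.2) + w q.2 = w p.2 := by rw [← map_add, tsub_add_cancel_of_le hqp.2]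
    have hlt : p - q < p := by
      refine (tsub_le_self : p - q ≤ p).lt_of_ne fun heq => hq.prop.1 ?_
      have := tsub_add_cancel_of_le hqp
      rw [heq] at this
      simpa using this
    have hw' : w (p - q).2 < w (p - q).1 := by
      by_contra! hcon
      have := add_le_add hcon h
      simp only [Prod.fst_sub, Prod.snd_sub, h1, h2] at this
      exact absurd hw (not_lt.2 this)
    obtain ⟨q', hq', hres⟩ := ih (p - q) hlt (hp.tsub hq.prop.2 hqp) hw'
    exact ⟨q', hq'.trans tsub_le_self, hres⟩

end BicoloredMultihypergraph

/-! ### Fibers of the toric map -/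

section Toric

variable (k : Type v) [Field k]

open Classical in
/-- The exponent of the monomial `x^e`. -/
noncomputable def edgeExponent (hV : H.vertexSet.Finite) (e : H.edgeSet) : H.vertexSet →₀ ℕ :=
  have := hV.to_subtype
  Finsupp.equivFunOnFinite.symm fun v => if (v : α) ∈ (e : Set α) then 1 else 0

lemma edgeMonomial_eq (hV : H.vertexSet.Finite) (e : H.edgeSet) :
    H.edgeMonomial k e = MvPolynomial.monomial (edgeExponent hV e) 1 := by
  classical
  have := hV.to_subtype
  have := Fintype.ofFinite H.vertexSet
  rw [MvPolynomial.monomial_eq, Finsupp.prod_fintype _ _ (by simp), edgeMonomial,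
    finprod_eq_prod_of_fintype]
  simp only [map_one, one_mul]
  refine Finset.prod_congr rfl fun v _ => ?_
  by_cases hv : (v : α) ∈ (e : Set α) <;> simp [edgeExponent, hv]

lemma sum_edgeExponent_apply (hV : H.vertexSet.Finite) (M : Multiset H.edgeSet)
    (v : H.vertexSet) : (M.map (edgeExponent hV)).sum v = degree M v := by
  classical
  induction M using Multiset.induction_on with
  | empty => simp
  | cons e M ih =>
    rw [Multiset.map_cons, Multiset.sum_cons, Finsupp.add_apply, ih, degree_cons, add_comm]
    simp [edgeExponent]

/-- The exponent at a vertex is its degree; outside `H.vertexSet` all degrees vanish, so quantifying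
over all of `α` adds no condition. -/
lemma sum_edgeExponent_eq_iff (hV : H.vertexSet.Finite) (M N : Multiset H.edgeSet) :
    (M.map (edgeExponent hV)).sum = (N.map (edgeExponent hV)).sum ↔ DegreesAgree (M, N) := by
  refine ⟨fun h v => ?_, fun h => ?_⟩
  · by_cases hv : v ∈ H.vertexSet
    · rw [← sum_edgeExponent_apply hV M ⟨v, hv⟩, ← sum_edgeExponent_apply hV N ⟨v, hv⟩, h]
    · have h0 (M : Multiset H.edgeSet) : degree M v = 0 := degree_eq_zero_iff.2 fun e _ hve =>
        hv (H.subset_vertexSet_of_mem_edgeSet' e.2 hve)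
      rw [h0, h0]
  · ext v
    rw [sum_edgeExponent_apply, sum_edgeExponent_apply]
    exact h v

lemma prod_map_X {σ : Type*} [DecidableEq σ] (M : Multiset σ) :
    (M.map (MvPolynomial.X (R := k))).prod = MvPolynomial.monomial (Multiset.toFinsupp M) 1 := by
  induction M using Multiset.induction_on with
  | empty => simp
  | cons e M ih =>
    rw [Multiset.map_cons, Multiset.prod_cons, ih, ← Multiset.singleton_add, map_add,
      Multiset.toFinsupp_singleton, MvPolynomial.X, MvPolynomial.monomial_mul, one_mul]

lemma prod_map_monomial {σ τ : Type*} (M : Multiset τ) (f : τ → σ →₀ ℕ) :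
    (M.map fun e => MvPolynomial.monomial (R := k) (f e) 1).prod =
      MvPolynomial.monomial (M.map f).sum 1 := by
  induction M using Multiset.induction_on with
  | empty => simp
  | cons e M ih =>
    rw [Multiset.map_cons, Multiset.prod_cons, ih, MvPolynomial.monomial_mul, one_mul,
      Multiset.map_cons, Multiset.sum_cons]

lemma toricMap_prod_X (hV : H.vertexSet.Finite) (M : Multiset H.edgeSet) :
    (H.toricMap k (M.map MvPolynomial.X).prod : MvPolynomial H.vertexSet k) =
      MvPolynomial.monomial (M.map (edgeExponent hV)).sum 1 := by
  rw [← prod_map_monomial, ← Subalgebra.coe_val, map_multiset_prod, map_multiset_prod,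
    Multiset.map_map, Multiset.map_map]
  congr 1
  refine Multiset.map_congr rfl fun e _ => ?_
  simp [toricMap, edgeMonomial_eq k hV]

lemma toricMap_monomial (hV : H.vertexSet.Finite) (a : H.edgeSet →₀ ℕ) (c : k) :
    (H.toricMap k (MvPolynomial.monomial a c) : MvPolynomial H.vertexSet k) =
      MvPolynomial.monomial ((Finsupp.toMultiset a).map (edgeExponent hV)).sum c := by
  classical
  have h : MvPolynomial.monomial a c =
      c • ((Finsupp.toMultiset a).map (MvPolynomial.X (R := k))).prod := by
    rw [prod_map_X, Finsupp.toMultiset_toFinsupp, MvPolynomial.smul_monomial, smul_eq_mul, mul_one]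
  rw [h, map_smul, Subalgebra.coe_smul, toricMap_prod_X k hV, MvPolynomial.smul_monomial,
    smul_eq_mul, mul_one]

lemma binomial_mem_toricIdeal (hV : H.vertexSet.Finite) {C : BicoloredMultihypergraph H}
    (hC : DegreesAgree (C.blue, C.red)) : C.binomial k ∈ H.toricIdeal k := by
  rw [toricIdeal, RingHom.mem_ker, binomial, map_sub, sub_eq_zero, Subtype.ext_iff,
    toricMap_prod_X k hV, toricMap_prod_X k hV, (sum_edgeExponent_eq_iff hV _ _).2 hC]

variable {k}

/-- No monomial of an element of the toric ideal is alone in its fiber. -/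
lemma exists_ne_mem_support_of_mem_toricIdeal (hV : H.vertexSet.Finite)
    {f : MvPolynomial H.edgeSet k} (hf : f ∈ H.toricIdeal k) {a : H.edgeSet →₀ ℕ}
    (ha : a ∈ f.support) :
    ∃ b ∈ f.support, b ≠ a ∧ DegreesAgree (Finsupp.toMultiset a, Finsupp.toMultiset b) := by
  classical
  by_contra! hcon
  rw [toricIdeal, RingHom.mem_ker] at hf
  have h : ((H.toricMap k f : H.edgeSubring k) : MvPolynomial H.vertexSet k) = 0 := by
    rw [hf, Subalgebra.coe_zero]
  conv_lhs at h => rw [f.as_sum]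
  rw [map_sum, ← Subalgebra.coe_val, map_sum] at h
  simp only [Subalgebra.coe_val, toricMap_monomial k hV] at h
  -- By `hcon` no other monomial of `f` has the same image as `a`, so this coefficient of the zero
  -- image is the nonzero coefficient of `a` in `f`.
  have h' := congrArg
    (MvPolynomial.coeff ((Finsupp.toMultiset a).map (edgeExponent hV)).sum) h
  rw [MvPolynomial.coeff_sum, MvPolynomial.coeff_zero, Finset.sum_eq_single a] at h'
  · rw [MvPolynomial.coeff_monomial, if_pos rfl] at h'
    exact MvPolynomial.mem_support_iff.1 ha h'
  · intro b hb hba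
    rw [MvPolynomial.coeff_monomial, if_neg]
    exact fun heq => hcon b hb hba ((sum_edgeExponent_eq_iff hV _ _).1 heq.symm)
  · exact fun h => absurd ha h

end Toric

end Hypergraph

/-! ### Leading terms and the conclusion -/

lemma MonomialOrder.leadingTerm_monomial_sub_monomial {σ : Type*} {k : Type*} [Field k]
    (m : MonomialOrder σ) {a b : σ →₀ ℕ} (h : m.toSyn b < m.toSyn a) :
    m.leadingTerm (MvPolynomial.monomial a (1 : k) - MvPolynomial.monomial b 1) =
      MvPolynomial.monomial a 1 := by
  classical
  have hdeg : m.degree (MvPolynomial.monomial a (1 : k) - MvPolynomial.monomial b 1) = a := by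
    rw [m.degree_sub_of_lt, m.degree_monomial, if_neg one_ne_zero]
    simpa [m.degree_monomial] using h
  have hne : b ≠ a := fun heq => h.ne (by rw [heq])
  rw [leadingTerm, leadingCoeff, hdeg]
  simp [MvPolynomial.coeff_monomial, hne]

open Hypergraph BicoloredMultihypergraph in
theorem corollary2p9 {α : Type u} (H : Hypergraph α) (hV : H.vertexSet.Finite)
    (d : ℕ) (hd : 1 ≤ d) (hH : H.IsUniform d) (k : Type v) [Field k] :
    IsUniversalGroebnerBasis
      {f : MvPolynomial H.edgeSet k |
        ∃ C : H.BicoloredMultihypergraph, C.IsPrimitiveMonomial ∧ f = C.binomial k}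
      (H.toricIdeal k) := by
  classical
  intro m
  have hsub : {f : MvPolynomial H.edgeSet k |
      ∃ C : H.BicoloredMultihypergraph, C.IsPrimitiveMonomial ∧ f = C.binomial k} ⊆
      H.toricIdeal k := by
    rintro _ ⟨C, hC, rfl⟩
    exact binomial_mem_toricIdeal k hV hC.degreesAgree
  refine ⟨?_, hsub, le_antisymm (Ideal.span_mono (Set.image_mono hsub)) ?_⟩
  · refine ((finite_isPrimitiveMonomial hV).image (binomial k)).subset ?_
    rintro _ ⟨C, hC, rfl⟩
    exact ⟨C, hC, rfl⟩
  · rw [Ideal.span_le]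
    rintro _ ⟨f, hf, rfl⟩
    rcases eq_or_ne f 0 with rfl | hf0
    · simp
    obtain ⟨b, hb, hne, hagree⟩ := exists_ne_mem_support_of_mem_toricIdeal hV hf
      (m.degree_mem_support hf0)
    have hlt : m.toSyn b < m.toSyn (m.degree f) :=
      (m.le_degree hb).lt_of_ne fun h => hne (m.toSyn.injective h)
    obtain ⟨q, hq, hmin, hqlt⟩ := exists_isMinimalPair_lt
      (m.toSyn.toAddMonoidHom.comp Multiset.toFinsupp.toAddMonoidHom) _ hagree
      (by simpa using hlt)
    have hqlt' : m.toSyn (Multiset.toFinsupp q.2) < m.toSyn (Multiset.toFinsupp q.1) := hqlt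
    have hle : Multiset.toFinsupp q.1 ≤ m.degree f := by
      have := Multiset.toFinsupp_strictMono.monotone hq.1
      simpa using this
    have hterm : m.leadingTerm f =
        MvPolynomial.monomial (m.degree f - Multiset.toFinsupp q.1) (m.leadingCoeff f) *
          m.leadingTerm (binomial k ⟨q.1, q.2⟩) := by
      rw [binomial, prod_map_X, prod_map_X, m.leadingTerm_monomial_sub_monomial hqlt',
        MvPolynomial.monomial_mul, tsub_add_cancel_of_le hle, mul_one]
      rfl
    rw [SetLike.mem_coe, hterm]
    exact Ideal.mul_mem_left _ _ (Ideal.subset_span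
      ⟨_, ⟨_, hmin.isPrimitiveMonomial hV hd hH, rfl⟩, rfl⟩)
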